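/- Let $1\le d$ and $D$ be integers and let $L,M,\tau,\varepsilon,T,\sigma>0$. Let $\operatorname{Lip}(L,M)$ be the set of $L$-Lipschitz maps $f:\mathbb{R}^D\to\mathbb{R}^D$ with $\|f(x)\|\le M$ for all $x$, and for such $f$ let $\phi(x,t)$ be the flow of $y'=f(y)$, i.e. $\phi(x,\cdot)$ is the unique global solution with $\phi(x,0)=x$. For $\mathcal X\subset\mathbb{R}^D$ put $\operatorname{Env}_f(\mathcal X,T)=\{\phi(x,t): x\in\mathcal X,\ t\in[0,T]\}$. The reach of a compact set $A\subset\mathbb{R}^D$ is the largest $R\in[0,\infty]$ such that each point of $\bigcup_{a\in A}B_2(a,R)$ has a unique nearest point in $A$. Let $\mathcal{P}(d,\tau,\varepsilon)$ be the set of probability distributions $\mu$ on $\mathbb{R}^D$ whose support is compact, is a $d$-dimensional smooth submanifold without boundary of $\mathbb{R}^D$ and has reach at least $\tau$, and which have a density $g$ with respect to the $d$-dimensional Riemannian volume measure of $\operatorname{supp}(\mu)$ such that $g\ge\varepsilon$ on $\operatorname{supp}(\mu)$. Assume that $\mathcal{P}(d,\tau,\varepsilon)$ is non-empty (that is, $\varepsilon$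 is not too large for $d$ and $\tau$, and $d<D$). For $n,m\ge1$, one observes $X_1,\dots,X_n$, i.i.d. with law $\mu$, and $$Y_{i,j}=\phi(X_i,t_j)+\sigma\,\xi_{i,j},\qquad 1\le i\le n,\ 1\le j\le m,\qquad t_j=jT/m,$$ where the $\xi_{i,j}$ are independent standard Gaussian vectors of $\mathbb{R}^D$, independent of the $X_i$. An estimator $\hat f$ assigns to each $x\in\mathbb{R}^D$ a measurable function $\hat f(x)\in\mathbb{R}^D$ of the observations. Then there is a constant $K>0$, depending only on $L,M,\varepsilon,\tau,d,D,T$ and $\sigma$, such that for all sufficiently large $n$ and $m$ $$\inf_{\hat f}\ \sup_{\substack{f\in\operatorname{Lip}(L,M)\\ \mu\in\mathcal{P}(d,\tau,\varepsilon)}}\ \sup_{x\in\operatorname{Env}_f(\operatorname{supp}(\mu),T)}\mathbb{E}\big[\|\hat f(x)-f(x)\|\big]\ \ge\ K\max\left(\Big(\frac1{nm}\Big)^{\frac1{5+d}},\Big(\frac1n\Big)^{\frac1d},\frac1m\right),$$ where the infimum is over all estimators $\hat f$ of $f$. -/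

import Mathlib

open Set Filter Topology MeasureTheory ProbabilityTheory
open scoped NNReal ENNReal ContDiff

noncomputable section

/-! ### Vector fields and their flows -/

/-- `Lip(L, M)`: the `L`-Lipschitz vector fields on `ℝ^D` with Euclidean norm bounded by `M`. -/
def LipClass (D : ℕ) (L : ℝ≥0) (M : ℝ) :
    Set (EuclideanSpace ℝ (Fin D) → EuclideanSpace ℝ (Fin D)) :=
  {f | LipschitzWith L f ∧ ∀ x, ‖f x‖ ≤ M}

/-- `y` is a global solution of `y' = f(y)` with `y(0) = x`. -/
def IsSolution {D : ℕ} (f : EuclideanSpace ℝ (Fin D) → EuclideanSpace ℝ (Fin D))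
    (x : EuclideanSpace ℝ (Fin D)) (y : ℝ → EuclideanSpace ℝ (Fin D)) : Prop :=
  y 0 = x ∧ IsIntegralCurve y (fun _ => f)

open Classical in
/-- The flow `φ(x, t)` of `y' = f(y)`. For `f` in `LipClass D L M` it is, for each `x`, the unique
global solution started at `x` (see `flow_isSolution` and `IsSolution.eq_flow` below). -/
def flow {D : ℕ} (f : EuclideanSpace ℝ (Fin D) → EuclideanSpace ℝ (Fin D))
    (x : EuclideanSpace ℝ (Fin D)) : ℝ → EuclideanSpace ℝ (Fin D) :=
  if h : ∃ y, IsSolution f x y then h.choose else fun _ => x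

theorem IsSolution.unique {D : ℕ} {L : ℝ≥0}
    {f : EuclideanSpace ℝ (Fin D) → EuclideanSpace ℝ (Fin D)} (hf : LipschitzWith L f)
    {x : EuclideanSpace ℝ (Fin D)} {y z : ℝ → EuclideanSpace ℝ (Fin D)}
    (hy : IsSolution f x y) (hz : IsSolution f x z) : y = z :=
  ODE_solution_unique_univ (v := fun _ => f) (s := fun _ => univ) (K := L) (t₀ := 0)
    (fun _ => hf.lipschitzOnWith) (fun t => ⟨hy.2 t, trivial⟩) (fun t => ⟨hz.2 t, trivial⟩)
    (hy.1.trans hz.1.symm)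

theorem exists_isSolution {D : ℕ} {L : ℝ≥0} {M : ℝ}
    {f : EuclideanSpace ℝ (Fin D) → EuclideanSpace ℝ (Fin D)} (hf : f ∈ LipClass D L M)
    (x : EuclideanSpace ℝ (Fin D)) : ∃ y, IsSolution f x y := by
  have hM : 0 ≤ M := (norm_nonneg _).trans (hf.2 x)
  have loc : ∀ N : ℕ, ∃ y : ℝ → EuclideanSpace ℝ (Fin D), y 0 = x ∧
      ∀ t ∈ Ioo (-(N + 1 : ℝ)) (N + 1), HasDerivAt y (f (y t)) t := by
    intro N
    have hN : (0 : ℝ) ∈ Icc (-(N + 1 : ℝ)) (N + 1) := ⟨by linarith [N.cast_nonneg (α := ℝ)],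
      by positivity⟩
    have hP : IsPicardLindelof (fun _ => f) (⟨0, hN⟩ : Icc (-(N + 1 : ℝ)) (N + 1)) x
        (M.toNNReal * (N + 1)) 0 M.toNNReal L :=
      IsPicardLindelof.of_time_independent
        (fun z _ => by rw [Real.coe_toNNReal _ hM]; exact hf.2 z) hf.1.lipschitzOnWith
        (by simp)
    obtain ⟨y, hy0, hy⟩ := hP.exists_eq_forall_mem_Icc_hasDerivWithinAt (x := x) (by simp)
    exact ⟨y, hy0, fun t ht =>
      (hy t (Ioo_subset_Icc_self ht)).hasDerivAt (Icc_mem_nhds ht.1 ht.2)⟩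
  choose y hy0 hy using loc
  have agree : ∀ N K : ℕ, N ≤ K → EqOn (y N) (y K) (Ioo (-(N + 1 : ℝ)) (N + 1)) := by
    intro N K hNK
    have hNK' : (N : ℝ) ≤ K := by exact_mod_cast hNK
    refine ODE_solution_unique_of_mem_Ioo (v := fun _ => f) (s := fun _ => univ) (K := L)
      (t₀ := 0) (fun _ _ => hf.1.lipschitzOnWith)
      ⟨by linarith [N.cast_nonneg (α := ℝ)], by positivity⟩
      (fun t ht => ⟨hy N t ht, trivial⟩)
      (fun t ht => ⟨hy K t ⟨by linarith [ht.1], by linarith [ht.2]⟩, trivial⟩) ?_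
    rw [hy0, hy0]
  refine ⟨fun t => y ⌈|t|⌉₊ t, by simp [hy0], fun t => ?_⟩
  obtain ⟨N, hN⟩ := exists_nat_ge (|t| + 1)
  have key : ∀ s ∈ Ioo (t - 1) (t + 1), y ⌈|s|⌉₊ s = y N s := by
    intro s hs
    have h1 : |s| ≤ N := by
      have h2 : |s| ≤ |t| + 1 := by
        have : |s - t| ≤ 1 := abs_le.2 ⟨by linarith [hs.1], by linarith [hs.2]⟩
        calc |s| = |t + (s - t)| := by ring_nf
          _ ≤ |t| + |s - t| := abs_add_le _ _
          _ ≤ _ := by linarith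
      linarith
    refine agree _ _ (Nat.ceil_le.2 h1) ?_
    have h3 := Nat.le_ceil |s|
    have h4 := abs_le.1 h3
    exact ⟨by linarith [h4.1], by linarith [h4.2]⟩
  have ht : t ∈ Ioo (-(N + 1 : ℝ)) (N + 1) := by
    have := abs_le.1 (show |t| ≤ N by linarith)
    exact ⟨by linarith [this.1], by linarith [this.2]⟩
  have hmem : Ioo (t - 1) (t + 1) ∈ 𝓝 t := Ioo_mem_nhds (by linarith) (by linarith)
  have h5 := (hy N t ht).congr_of_eventuallyEq (Filter.eventually_of_mem hmem key)
  rwa [← key t (mem_of_mem_nhds hmem)] at h5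

theorem flow_isSolution {D : ℕ} {L : ℝ≥0} {M : ℝ}
    {f : EuclideanSpace ℝ (Fin D) → EuclideanSpace ℝ (Fin D)} (hf : f ∈ LipClass D L M)
    (x : EuclideanSpace ℝ (Fin D)) : IsSolution f x (flow f x) := by
  have h := exists_isSolution hf x
  rw [flow, dif_pos h]
  exact h.choose_spec

theorem IsSolution.eq_flow {D : ℕ} {L : ℝ≥0} {M : ℝ}
    {f : EuclideanSpace ℝ (Fin D) → EuclideanSpace ℝ (Fin D)} (hf : f ∈ LipClass D L M)
    {x : EuclideanSpace ℝ (Fin D)} {y : ℝ → EuclideanSpace ℝ (Fin D)}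
    (hy : IsSolution f x y) : y = flow f x :=
  hy.unique hf.1 (flow_isSolution hf x)

/-- `Env_f(𝒳, T) = {φ(x, t) : x ∈ 𝒳, t ∈ [0, T]}`. -/
def Env {D : ℕ} (f : EuclideanSpace ℝ (Fin D) → EuclideanSpace ℝ (Fin D))
    (S : Set (EuclideanSpace ℝ (Fin D))) (T : ℝ) : Set (EuclideanSpace ℝ (Fin D)) :=
  {z | ∃ x ∈ S, ∃ t ∈ Icc 0 T, flow f x t = z}

/-! ### The class of initial distributions -/

/-- The reach of `A`: the largest `R` such that each point of `A ⊕ R = ⋃_{a ∈ A} B(a, R)` has a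
unique projection (nearest point) on `A`. -/
def reach {D : ℕ} (A : Set (EuclideanSpace ℝ (Fin D))) : ℝ≥0∞ :=
  ⨆ (R : ℝ≥0) (_ : ∀ x ∈ Metric.thickening (R : ℝ) A, ∃! a, a ∈ A ∧ dist x a = Metric.infDist x A),
    (R : ℝ≥0∞)

/-- `S` is a `d`-dimensional smooth embedded submanifold (without boundary) of `ℝ^D`: around each
of its points there is a smooth local diffeomorphism of `ℝ^D` (a slice chart) which straightens
`S` to the coordinate `d`-plane where all but the first `d` coordinates vanish. -/
def IsSubmanifold {D : ℕ} (d : ℕ) (S : Set (EuclideanSpace ℝ (Fin D))) : Prop :=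
  d ≤ D ∧ ∀ p ∈ S,
    ∃ Φ : OpenPartialHomeomorph (EuclideanSpace ℝ (Fin D)) (EuclideanSpace ℝ (Fin D)),
      p ∈ Φ.source ∧ ContDiffOn ℝ ∞ Φ Φ.source ∧ ContDiffOn ℝ ∞ Φ.symm Φ.target ∧
      ∀ x ∈ Φ.source, x ∈ S ↔ ∀ i : Fin D, d ≤ (i : ℕ) → Φ x i = 0

/-- `𝒫(d, τ, ε)`: the probability distributions `μ` on `ℝ^D` whose support is compact, is a
`d`-dimensional submanifold of `ℝ^D` and has reach at least `τ`, and which admit a density `g` with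
respect to the `d`-dimensional (Riemannian) volume measure of the support, with `g ≥ ε` on the
support. The volume measure is the Hausdorff measure `μHE[d]`, normalized so as to agree with
Lebesgue measure on `d`-dimensional Euclidean spaces. -/
def ManifoldClass (D d : ℕ) (τ ε : ℝ) : Set (ProbabilityMeasure (EuclideanSpace ℝ (Fin D))) :=
  {μ | IsCompact (μ : Measure (EuclideanSpace ℝ (Fin D))).support ∧
    IsSubmanifold d (μ : Measure (EuclideanSpace ℝ (Fin D))).support ∧
    ENNReal.ofReal τ ≤ reach (μ : Measure (EuclideanSpace ℝ (Fin D))).support ∧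
    ∃ g : EuclideanSpace ℝ (Fin D) → ℝ≥0∞, Measurable g ∧
      (∀ x ∈ (μ : Measure (EuclideanSpace ℝ (Fin D))).support, ENNReal.ofReal ε ≤ g x) ∧
      (μ : Measure (EuclideanSpace ℝ (Fin D))) =
        ((μHE[d] : Measure (EuclideanSpace ℝ (Fin D))).restrict
          (μ : Measure (EuclideanSpace ℝ (Fin D))).support).withDensity g}

/-! ### Observations, estimators and risk -/

/-- The data: `n` initial values `X_i` and `n * m` noisy values `Y_{i,j}`. -/
abbrev Data (D n m : ℕ) : Type :=
  (Fin n → EuclideanSpace ℝ (Fin D)) × (Fin n → Fin m → EuclideanSpace ℝ (Fin D))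

/-- The regular time grid `t_j = j T / m`, `1 ≤ j ≤ m`; the index `j : Fin m` stands for `j + 1`. -/
def gridTime (T : ℝ) (m : ℕ) (j : Fin m) : ℝ := ((j : ℕ) + 1 : ℝ) * T / m

/-- The observations `(X_i, Y_{i,j})` with `Y_{i,j} = φ(X_i, t_j) + σ ξ_{i,j}`, as a function of the
initial values and of the noise. -/
def observe {D n m : ℕ} (f : EuclideanSpace ℝ (Fin D) → EuclideanSpace ℝ (Fin D)) (T σ : ℝ)
    (w : Data D n m) : Data D n m :=
  (w.1, fun i j => flow f (w.1 i) (gridTime T m j) + σ • w.2 i j)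

/-- The joint law of the initial values and the noise: the `X_i` are i.i.d. of law `μ`, the
`ξ_{i,j}` are i.i.d. standard Gaussian vectors of `ℝ^D`, and they are independent of the `X_i`. -/
def designLaw {D : ℕ} (n m : ℕ) (μ : Measure (EuclideanSpace ℝ (Fin D))) :
    Measure (Data D n m) :=
  (Measure.pi fun _ : Fin n => μ).prod
    (Measure.pi fun _ : Fin n => Measure.pi fun _ : Fin m =>
      stdGaussian (EuclideanSpace ℝ (Fin D)))

/-- An estimator of the vector field: the estimate `f̂(x)` is a measurable function of the data,
for each point `x`. -/
def IsEstimator {D n m : ℕ}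
    (e : Data D n m → EuclideanSpace ℝ (Fin D) → EuclideanSpace ℝ (Fin D)) : Prop :=
  ∀ x, Measurable fun w => e w x

/-- The pointwise risk `𝔼 ‖f̂(x) - f(x)‖`. -/
def pointwiseRisk {D n m : ℕ} (T σ : ℝ)
    (e : Data D n m → EuclideanSpace ℝ (Fin D) → EuclideanSpace ℝ (Fin D))
    (f : EuclideanSpace ℝ (Fin D) → EuclideanSpace ℝ (Fin D))
    (μ : Measure (EuclideanSpace ℝ (Fin D))) (x : EuclideanSpace ℝ (Fin D)) : ℝ≥0∞ :=
  ∫⁻ w, ‖e (observe f T σ w) x - f x‖ₑ ∂(designLaw n m μ)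

/-- The minimax pointwise risk over `Lip(L, M)` and `𝒫(d, τ, ε)`. -/
def minimaxPointwiseRisk (D d : ℕ) (L : ℝ≥0) (M τ ε T σ : ℝ) (n m : ℕ) : ℝ≥0∞ :=
  ⨅ (e : Data D n m → EuclideanSpace ℝ (Fin D) → EuclideanSpace ℝ (Fin D)) (_ : IsEstimator e),
    ⨆ (f ∈ LipClass D L M) (μ ∈ ManifoldClass D d τ ε)
      (x ∈ Env f (μ : Measure (EuclideanSpace ℝ (Fin D))).support T),
      pointwiseRisk T σ e f (μ : Measure (EuclideanSpace ℝ (Fin D))) x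

end

/-! This is Le Cam's two-point method: two fields of the class that differ by `L * ρ` at a common
point of their envelopes, but whose data are nearly indistinguishable. Both fields point along a
fixed unit vector `v` with base speed `A = M / 2`, and each carries a cone of slope `L` and radius
`ρ` (`bumpField`), centred at `q + ρ • v` and `q - ρ • v` respectively. The initial law is uniform
on a support `S` of the class; `p` minimizes `⟪v, ·⟫` on `S`, and `q = p + (3 * ρ) • v` lies just
outside `S`.

All trajectories are lines parallel to `v`. Those starting in `S` farther than `10 * ρ` from `p`
miss both cones (`flow_bumpField_eq_of_far`). The others start before both cones, since `S` is
tangent at `p` to the hyperplane orthogonal to `v` (`IsSubmanifold.eventually_inner_le`). The cones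
are mirror images, so crossing both takes the same time under either field, and the flows coincide
again after time `6 * ρ / A` (`flow_bumpField_eq_of_le`). Until then they differ by `O(ρ ^ 2)`.

Thus a sample point is informative with probability `O(ρ ^ d)`, at `O(ρ * m)` observation times,
each contributing `O(ρ ^ 4)` to the squared Gaussian shift. The fields cannot be told apart if `n *
ρ ^ d` is small (no informative start), if `n * m * ρ ^ (5 + d)` is small (too much noise), or if `m
* ρ` is small (no observation during the crossing). The largest such `ρ` in each regime gives one of
the three rates. -/

/-! ### Gaussian shifts and the two-point inequality. -/

/-- `ν` is symmetric, and its translate by `h` has density `exp (ℓ - q / 2)` with `ℓ` odd, as is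
the case for a standard Gaussian measure, with `ℓ = ⟪h, ·⟫` and `q = ‖h‖ ^ 2`. -/
structure GaussianShift {V : Type*} [AddCommGroup V] [MeasurableSpace V] (ν : Measure V) (h : V)
    (q : ℝ) (ℓ : V → ℝ) : Prop where
  measurable : Measurable ℓ
  odd : ∀ x, ℓ (-x) = -ℓ x
  symm : ν.map (fun x => -x) = ν
  map_add : ν.map (fun x => x + h) = ν.withDensity fun x => ENNReal.ofReal (Real.exp (ℓ x - q / 2))

theorem gaussianShift_gaussianReal (h : ℝ) :
    GaussianShift (gaussianReal 0 1) h (h ^ 2) fun x => h * x where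
  measurable := by fun_prop
  odd x := by ring
  symm := by rw [gaussianReal_map_neg, neg_zero]
  map_add := by
    rw [gaussianReal_map_add_const, gaussianReal_of_var_ne_zero _ one_ne_zero,
      gaussianReal_of_var_ne_zero _ one_ne_zero, ← withDensity_mul _ (measurable_gaussianPDF 0 1)
        (by fun_prop)]
    congr 1
    ext x
    simp only [gaussianPDF, Pi.mul_apply]
    rw [← ENNReal.ofReal_mul (gaussianPDFReal_nonneg _ _ _)]
    simp only [gaussianPDFReal, NNReal.coe_one, mul_one]
    rw [mul_assoc, ← Real.exp_add]
    congr 3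
    ring

theorem withDensity_pi {ι : Type*} [Fintype ι] {V : ι → Type*} [∀ i, MeasurableSpace (V i)]
    (ν : ∀ i, Measure (V i)) [∀ i, IsProbabilityMeasure (ν i)] (Z : ∀ i, V i → ℝ≥0∞)
    (hZ : ∀ i, Measurable (Z i)) (hint : ∀ i, ∫⁻ x, Z i x ∂ν i ≠ ⊤) :
    Measure.pi (fun i => (ν i).withDensity (Z i)) =
      (Measure.pi ν).withDensity fun x => ∏ i, Z i (x i) := by
  have := fun i => isFiniteMeasure_withDensity (hint i)
  refine Measure.pi_eq fun s hs => ?_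
  rw [withDensity_apply _ (MeasurableSet.univ_pi hs), ← lintegral_indicator (.univ_pi hs)]
  have h1 : (Set.pi univ s).indicator (fun x => ∏ i, Z i (x i)) =
      fun x => ∏ i, (s i).indicator (Z i) (x i) := by
    ext x
    classical
    by_cases hx : x ∈ Set.pi univ s
    · rw [indicator_of_mem hx]
      exact Finset.prod_congr rfl fun i _ => (indicator_of_mem (hx i trivial) _).symm
    · rw [indicator_of_notMem hx]
      simp only [Set.mem_pi, mem_univ, true_imp_iff, not_forall] at hx
      obtain ⟨i, hi⟩ := hx
      exact (Finset.prod_eq_zero (Finset.mem_univ i) (indicator_of_notMem hi _)).symm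
  have hm : ∀ i, Measurable ((s i).indicator (Z i)) := fun i => (hZ i).indicator (hs i)
  rw [h1, lintegral_prod_eq_prod_lintegral_of_indepFun Finset.univ _
    (iIndepFun_pi fun i => (hm i).aemeasurable) fun i => (hm i).comp (measurable_pi_apply i)]
  refine Finset.prod_congr rfl fun i _ => ?_
  rw [withDensity_apply _ (hs i), ← lintegral_indicator (hs i)]
  exact (measurePreserving_eval ν i).lintegral_comp (hm i)

theorem GaussianShift.lintegral_eq_one {V : Type*} [AddCommGroup V] [MeasurableSpace V]
    [MeasurableAdd V] {ν : Measure V} [IsProbabilityMeasure ν] {h : V} {q : ℝ} {ℓ : V → ℝ}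
    (H : GaussianShift ν h q ℓ) : ∫⁻ x, ENNReal.ofReal (Real.exp (ℓ x - q / 2)) ∂ν = 1 := by
  rw [← setLIntegral_univ, ← withDensity_apply _ MeasurableSet.univ, ← H.map_add,
    Measure.map_apply (by fun_prop) MeasurableSet.univ, preimage_univ, measure_univ]

/-- Log-likelihoods of independent shifts add up, and a sum of odd functions is odd. Applied to
coordinates, then to observation times, then to sample points. -/
theorem GaussianShift.pi {ι : Type*} [Fintype ι] {V : Type*} [AddCommGroup V]
    [MeasurableSpace V] [MeasurableAdd V] [MeasurableNeg V] {ν : Measure V}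
    [IsProbabilityMeasure ν] {h : ι → V} {q : ι → ℝ} {ℓ : ι → V → ℝ}
    (H : ∀ i, GaussianShift ν (h i) (q i) (ℓ i)) :
    GaussianShift (Measure.pi fun _ : ι => ν) h (∑ i, q i) fun x => ∑ i, ℓ i (x i) where
  measurable := Finset.measurable_sum _ fun i _ => (H i).measurable.comp (measurable_pi_apply i)
  odd x := by simp [(H _).odd]
  symm := by
    have := Measure.pi_map_pi (μ := fun _ : ι => ν) (f := fun (_ : ι) (x : V) => -x)
      (fun i => measurable_neg.aemeasurable)
    -- Symmetry of `ν` is only available through some index; over an empty index type negation is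
    -- the identity.
    by_cases hι : Nonempty ι
    · simp only [(H hι.some).symm] at this
      exact this
    · have := not_nonempty_iff.1 hι
      have e : (fun x : ι → V => -x) = id := by ext x i; exact (hι ⟨i⟩).elim
      rw [e, Measure.map_id]
  map_add := by
    have := Measure.pi_map_pi (μ := fun _ : ι => ν) (f := fun (i : ι) (x : V) => x + h i)
      (fun i => (measurable_add_const _).aemeasurable)
    simp only [(H _).map_add] at this
    rw [withDensity_pi (fun _ : ι => ν) _
      (fun i => ((H i).measurable.sub_const _).exp.ennreal_ofReal)
      (fun i => by rw [(H i).lintegral_eq_one]; simp)] at this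
    refine Eq.trans ?_ (this.trans ?_)
    · rfl
    · congr 1
      ext x
      rw [← ENNReal.ofReal_prod_of_nonneg fun i _ => (Real.exp_pos _).le, ← Real.exp_sum,
        Finset.sum_sub_distrib, Finset.sum_div]

theorem gaussianShift_stdGaussian {D : ℕ} (h : EuclideanSpace ℝ (Fin D)) :
    ∃ ℓ, GaussianShift (stdGaussian (EuclideanSpace ℝ (Fin D))) h (‖h‖ ^ 2) ℓ := by
  have H := GaussianShift.pi fun i => gaussianShift_gaussianReal (h i)
  have hm : Measurable (WithLp.toLp 2 : (Fin D → ℝ) → EuclideanSpace ℝ (Fin D)) :=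
    by fun_prop
  refine ⟨fun x => ∑ i, h i * x i, by fun_prop, fun x => by simp, ?_, ?_⟩
  · rw [← map_pi_eq_stdGaussian, Measure.map_map measurable_neg hm]
    conv_rhs => rw [← H.symm, Measure.map_map hm measurable_neg]
    rfl
  · rw [← map_pi_eq_stdGaussian, Measure.map_map (measurable_add_const _) hm]
    have : ((fun x => x + h) ∘ (WithLp.toLp 2 : (Fin D → ℝ) → EuclideanSpace ℝ (Fin D))) =
        WithLp.toLp 2 ∘ fun x => x + (fun i => h i) := rfl
    rw [this, ← Measure.map_map hm (measurable_add_const _), H.map_add]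
    ext s hs
    rw [Measure.map_apply hm hs, withDensity_apply _ (hm hs), withDensity_apply _ hs,
      setLIntegral_map hs (by fun_prop) hm]
    simp [EuclideanSpace.real_norm_sq_eq]

/-- Negation preserves `ν` and exchanges `{0 ≤ ℓ}` with `{ℓ ≤ 0}`; these sets cover the space. -/
theorem GaussianShift.half_le {V : Type*} [AddCommGroup V] [MeasurableSpace V] [MeasurableNeg V]
    {ν : Measure V} [IsProbabilityMeasure ν] {h : V} {q : ℝ} {ℓ : V → ℝ}
    (H : GaussianShift ν h q ℓ) : 1 / 2 ≤ ν {x | 0 ≤ ℓ x} := by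
  have h1 : ν {x | ℓ x ≤ 0} = ν {x | 0 ≤ ℓ x} := by
    conv_rhs => rw [← H.symm, Measure.map_apply measurable_neg
      (measurableSet_le measurable_const H.measurable)]
    congr 1
    ext x
    simp [H.odd]
  have h2 : 1 ≤ ν {x | 0 ≤ ℓ x} + ν {x | ℓ x ≤ 0} := by
    rw [← measure_univ (μ := ν)]
    refine (measure_mono fun x _ => ?_).trans (measure_union_le _ _)
    exact le_total 0 (ℓ x)
  rw [h1, ← two_mul] at h2
  rw [ENNReal.div_le_iff' (by simp) (by simp)]
  exact h2

/-- Le Cam's two point bound for two translates of a Gaussian. -/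
theorem GaussianShift.le_lintegral_add {V : Type*} [AddCommGroup V] [MeasurableSpace V]
    [MeasurableAdd V] [MeasurableNeg V] {ν : Measure V} [IsProbabilityMeasure ν] {h : V} {q : ℝ}
    {ℓ : V → ℝ} (H : GaussianShift ν h q ℓ) (hq : 0 ≤ q) {F G : V → ℝ≥0∞} (hF : Measurable F)
    (hG : Measurable G) {Δ : ℝ≥0∞} (hΔ : ∀ x, Δ ≤ F x + G x) :
    Δ * ENNReal.ofReal (Real.exp (-(q / 2))) / 2 ≤ ∫⁻ x, F (x + h) ∂ν + ∫⁻ x, G x ∂ν := by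
  have hZ : Measurable fun x => ENNReal.ofReal (Real.exp (ℓ x - q / 2)) :=
    (H.measurable.sub_const _).exp.ennreal_ofReal
  rw [← lintegral_map (f := F) hF (measurable_add_const h), H.map_add,
    lintegral_withDensity_eq_lintegral_mul _ hZ hF, ← lintegral_add_right _ hG]
  have hs : MeasurableSet {x | 0 ≤ ℓ x} := measurableSet_le measurable_const H.measurable
  calc Δ * ENNReal.ofReal (Real.exp (-(q / 2))) / 2
      = Δ * ENNReal.ofReal (Real.exp (-(q / 2))) * (1 / 2) := by
        rw [div_eq_mul_inv, one_div]
    _ ≤ Δ * ENNReal.ofReal (Real.exp (-(q / 2))) * ν {x | 0 ≤ ℓ x} := by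
        gcongr
        exact H.half_le
    _ = ∫⁻ _ in {x | 0 ≤ ℓ x}, Δ * ENNReal.ofReal (Real.exp (-(q / 2))) ∂ν := by simp
    _ ≤ ∫⁻ x in {x | 0 ≤ ℓ x},
        (((fun x => ENNReal.ofReal (Real.exp (ℓ x - q / 2))) * F) x + G x) ∂ν := by
        refine setLIntegral_mono' hs fun x hx => ?_
        -- On `{0 ≤ ℓ}` both the likelihood ratio and `1` are at least `c`, so `c * (F + G)` bounds
        -- the integrand from below.
        set c := ENNReal.ofReal (Real.exp (-(q / 2)))
        have hc1 : c ≤ 1 := by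
          rw [← ENNReal.ofReal_one]
          exact ENNReal.ofReal_le_ofReal (Real.exp_le_one_iff.2 (by linarith))
        have hc2 : c ≤ ENNReal.ofReal (Real.exp (ℓ x - q / 2)) :=
          ENNReal.ofReal_le_ofReal (Real.exp_le_exp.2 (by
            have : 0 ≤ ℓ x := hx
            linarith))
        calc Δ * c ≤ (F x + G x) * c := by gcongr; exact hΔ x
          _ = c * F x + c * G x := by ring
          _ ≤ ENNReal.ofReal (Real.exp (ℓ x - q / 2)) * F x + 1 * G x := by gcongr
          _ = _ := by simp
    _ ≤ _ := setLIntegral_le_lintegral _ _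

/-! ### Local geometry of submanifolds, and the uniform law. -/

/-- A slice chart followed by the projection to the first `d` coordinates gives `π`; the inclusion
of the coordinate plane followed by the inverse chart gives `ψ`. Class `C^1` suffices for both
tangency and volume bounds. -/
theorem IsSubmanifold.exists_parametrization {D d : ℕ} {S : Set (EuclideanSpace ℝ (Fin D))}
    (hS : IsSubmanifold d S) {p : EuclideanSpace ℝ (Fin D)} (hp : p ∈ S) :
    ∃ (ψ : EuclideanSpace ℝ (Fin d) → EuclideanSpace ℝ (Fin D))
      (π : EuclideanSpace ℝ (Fin D) → EuclideanSpace ℝ (Fin d)),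
      ContDiffAt ℝ 1 ψ (π p) ∧ ContDiffAt ℝ 1 π p ∧ ψ (π p) = p ∧
      (∀ᶠ z in 𝓝 (π p), ψ z ∈ S) ∧ ∀ᶠ x in 𝓝 p, x ∈ S → ψ (π x) = x := by
  obtain ⟨hdD, hS⟩ := hS
  obtain ⟨Φ, hpΦ, hΦ, hΦ', hiff⟩ := hS p hp
  let ι : EuclideanSpace ℝ (Fin d) → EuclideanSpace ℝ (Fin D) := fun z =>
    WithLp.toLp 2 fun i => if h : (i : ℕ) < d then z ⟨i, h⟩ else 0
  let P : EuclideanSpace ℝ (Fin D) → EuclideanSpace ℝ (Fin d) := fun x =>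
    WithLp.toLp 2 fun i => x (Fin.castLE hdD i)
  have hι : ContDiff ℝ 1 ι := by
    refine contDiff_euclidean.2 fun i => ?_
    by_cases h : (i : ℕ) < d
    · simp only [ι, h, dite_true]
      fun_prop
    · simp only [ι, h, dite_false]
      fun_prop
  have hP : ContDiff ℝ 1 P := by
    refine contDiff_euclidean.2 fun i => ?_
    simp only [P]
    fun_prop
  have hιP : ∀ x ∈ Φ.source, x ∈ S → ι (P (Φ x)) = Φ x := by
    intro x hx hxS
    ext i
    by_cases h : (i : ℕ) < d
    · simp [ι, P, h]
    · simp only [ι, h, dite_false]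
      exact ((hiff x hx).1 hxS i (not_lt.1 h)).symm
  have hιp := hιP p hpΦ hp
  have hΦp : ContDiffAt ℝ ∞ Φ p := (hΦ p hpΦ).contDiffAt (Φ.open_source.mem_nhds hpΦ)
  have hΦp' : ContDiffAt ℝ ∞ Φ.symm (Φ p) :=
    (hΦ' _ (Φ.map_source hpΦ)).contDiffAt (Φ.open_target.mem_nhds (Φ.map_source hpΦ))
  refine ⟨fun z => Φ.symm (ι z), fun x => P (Φ x), ?_, ?_, ?_, ?_, ?_⟩
  · refine ContDiffAt.comp _ ?_ hι.contDiffAt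
    rw [hιp]
    exact hΦp'.of_le (by exact_mod_cast le_top)
  · exact hP.contDiffAt.comp _ (hΦp.of_le (by exact_mod_cast le_top))
  · simp only [hιp]
    exact Φ.left_inv hpΦ
  · have : ∀ᶠ z in 𝓝 (P (Φ p)), ι z ∈ Φ.target := by
      refine hι.continuous.continuousAt.eventually_mem ?_
      rw [hιp]
      exact Φ.open_target.mem_nhds (Φ.map_source hpΦ)
    filter_upwards [this] with z hz
    rw [hiff _ (Φ.map_target hz)]
    intro i hi
    rw [Φ.right_inv hz]
    simp [ι, not_lt.2 hi]
  · filter_upwards [Φ.open_source.mem_nhds hpΦ] with x hx hxS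
    rw [hιP x hx hxS, Φ.left_inv hx]

/-- A submanifold lies flat along its supporting hyperplanes. -/
theorem IsSubmanifold.eventually_inner_le {D d : ℕ} {S : Set (EuclideanSpace ℝ (Fin D))}
    (hS : IsSubmanifold d S) {p : EuclideanSpace ℝ (Fin D)} (hp : p ∈ S)
    {v : EuclideanSpace ℝ (Fin D)} (hmin : ∀ x ∈ S, inner ℝ v p ≤ inner ℝ v x) {η : ℝ}
    (hη : 0 < η) : ∀ᶠ x in 𝓝 p, x ∈ S → inner ℝ v (x - p) ≤ η * ‖x - p‖ := by
  obtain ⟨ψ, π, hψ, hπ, hp', hmem, hinv⟩ := hS.exists_parametrization hp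
  have hd : DifferentiableAt ℝ (fun z => inner ℝ v (ψ z)) (π p) :=
    (differentiableAt_const v).inner ℝ (hψ.differentiableAt one_ne_zero)
  -- There is no boundary, so `π p` is an interior minimum of the height in the parameter space and
  -- the derivative vanishes there.
  have hloc : IsLocalMin (fun z => inner ℝ v (ψ z)) (π p) := by
    filter_upwards [hmem] with z hz
    rw [hp']
    exact hmin _ hz
  have h0 := hd.hasFDerivAt
  rw [hloc.fderiv_eq_zero] at h0
  have ho : (fun x => inner ℝ v (ψ (π x)) - inner ℝ v (ψ (π p))) =o[𝓝 p] fun x => π x - π p := by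
    have := h0.isLittleO
    simp only [zero_apply, sub_zero] at this
    exact this.comp_tendsto hπ.continuousAt
  -- Differentiability of `π` at `p` turns `o(‖π x - π p‖)` into `o(‖x - p‖)`.
  have := ho.trans_isBigO (hπ.differentiableAt one_ne_zero).hasFDerivAt.isBigO_sub
  filter_upwards [hinv, this.bound hη] with x hx hb hxS
  rw [hx hxS, hp', ← inner_sub_right] at hb
  exact (le_abs_self _).trans hb

/-- Near `p`, the part of `S` in a ball of radius `r` lies in the image under the Lipschitz map `ψ`
of a `d`-dimensional ball of radius `Kπ * r`. -/
theorem IsSubmanifold.exists_measure_closedBall_le {D d : ℕ}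
    {S : Set (EuclideanSpace ℝ (Fin D))} (hS : IsSubmanifold d S)
    {p : EuclideanSpace ℝ (Fin D)} (hp : p ∈ S) :
    ∃ C : ℝ, 0 ≤ C ∧ ∀ᶠ r in 𝓝[>] (0 : ℝ),
      (μHE[d] : Measure (EuclideanSpace ℝ (Fin D))) (S ∩ Metric.closedBall p r) ≤
        ENNReal.ofReal (C * r ^ d) := by
  obtain ⟨ψ, π, hψ, hπ, hp', hmem, hinv⟩ := hS.exists_parametrization hp
  obtain ⟨Kψ, U, hU, hLψ⟩ := hψ.exists_lipschitzOnWith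
  obtain ⟨Kπ, W, hW, hLπ⟩ := hπ.exists_lipschitzOnWith
  obtain ⟨r₁, hr₁, hr₁U⟩ := Metric.nhds_basis_closedBall.mem_iff.1 hU
  obtain ⟨r₂, hr₂, hr₂W⟩ := Metric.nhds_basis_closedBall.mem_iff.1 (inter_mem hW hinv)
  have key : ∀ r, 0 < r → r ≤ r₂ → Kπ * r ≤ r₁ →
      (μHE[d] : Measure (EuclideanSpace ℝ (Fin D))) (S ∩ Metric.closedBall p r) ≤
        (Kψ : ℝ≥0∞) ^ d * volume (Metric.closedBall (π p) (Kπ * r)) := by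
    intro r hr0 hr hr'
    have hsub : S ∩ Metric.closedBall p r ⊆ ψ '' Metric.closedBall (π p) (Kπ * r) := by
      rintro x ⟨hxS, hx⟩
      have hx2 := hr₂W (Metric.closedBall_subset_closedBall hr hx)
      refine ⟨π x, ?_, hx2.2 hxS⟩
      have := hLπ.dist_le_mul x hx2.1 p (hr₂W (Metric.mem_closedBall_self hr₂.le)).1
      exact this.trans (by gcongr; exact hx)
    refine (measure_mono hsub).trans ?_
    have hL : LipschitzOnWith Kψ ψ (Metric.closedBall (π p) (Kπ * r)) :=
      hLψ.mono ((Metric.closedBall_subset_closedBall hr').trans hr₁U)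
    have h1 := hL.hausdorffMeasure_image_le (d := (d : ℝ)) (by positivity)
    rw [← EuclideanSpace.euclideanHausdorffMeasure_eq_volume]
    simp only [Measure.euclideanHausdorffMeasure_def, Measure.smul_apply]
    rw [ENNReal.smul_def, ENNReal.smul_def, smul_eq_mul, smul_eq_mul, mul_left_comm]
    gcongr
    simpa using h1
  refine ⟨(Kψ : ℝ) ^ d * ((Kπ : ℝ) ^ d *
    (volume (Metric.ball (0 : EuclideanSpace ℝ (Fin d)) 1)).toReal), by positivity, ?_⟩
  have e1 : ∀ᶠ r in 𝓝[>] (0 : ℝ), r ≤ r₂ :=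
    nhdsWithin_le_nhds (eventually_le_nhds hr₂)
  have e2 : ∀ᶠ r in 𝓝[>] (0 : ℝ), Kπ * r ≤ r₁ := by
    have : Tendsto (fun r : ℝ => Kπ * r) (𝓝 0) (𝓝 (Kπ * 0)) := tendsto_id.const_mul _
    rw [mul_zero] at this
    exact nhdsWithin_le_nhds (this.eventually (eventually_le_nhds hr₁))
  filter_upwards [e1, e2, self_mem_nhdsWithin] with r h1 h2 h3
  have h3 : 0 < r := h3
  refine (key r h3 h1 h2).trans_eq ?_
  rw [Measure.addHaar_closedBall _ _ (by positivity), finrank_euclideanSpace_fin,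
    ← ENNReal.ofReal_toReal (measure_ball_lt_top (μ := volume)
      (x := (0 : EuclideanSpace ℝ (Fin d))) (r := 1)).ne, ← ENNReal.ofReal_mul (by positivity),
    ← ENNReal.ofReal_coe_nnreal, ← ENNReal.ofReal_pow (by positivity),
    ← ENNReal.ofReal_mul (by positivity)]
  congr 1
  rw [ENNReal.toReal_ofReal (by positivity)]
  ring

/-- The uniform law on the support of a member of the class is again in the class. -/
theorem exists_uniform_mem_manifoldClass {D d : ℕ} {τ ε : ℝ} (hε : 0 < ε)
    (hne : (ManifoldClass D d τ ε).Nonempty) :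
    ∃ μ ∈ ManifoldClass D d τ ε, ∃ c : ℝ≥0∞, c ≠ ⊤ ∧
      (μ : Measure (EuclideanSpace ℝ (Fin D))) = c • (μHE[d] : Measure _).restrict
        (μ : Measure (EuclideanSpace ℝ (Fin D))).support := by
  obtain ⟨μ, hc, hsub, hr, g, hg, hge, hμ⟩ := hne
  set S := (μ : Measure (EuclideanSpace ℝ (Fin D))).support with hS
  set H : Measure (EuclideanSpace ℝ (Fin D)) := (μHE[d] : Measure _).restrict S with hH
  have hSc : IsClosed S := Measure.isClosed_support
  have hε' : ENNReal.ofReal ε ≠ 0 := by simpa using hε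
  -- This yields both finiteness of the volume and `ε ≤ (H univ)⁻¹`, the density bound required of
  -- the uniform law.
  have h1 : ENNReal.ofReal ε * H univ ≤ 1 := by
    rw [← measure_univ (μ := (μ : Measure (EuclideanSpace ℝ (Fin D)))), hμ,
      withDensity_apply _ MeasurableSet.univ, Measure.restrict_univ, ← lintegral_const]
    refine lintegral_mono_ae ?_
    filter_upwards [ae_restrict_mem hSc.measurableSet] with x hx using hge x hx
  have hac : (μ : Measure (EuclideanSpace ℝ (Fin D))) ≪ H := by
    rw [hμ]; exact withDensity_absolutelyContinuous _ _
  have h0 : H univ ≠ 0 := fun h => by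
    have := hac h
    simp at this
  have htop : H univ ≠ ⊤ := fun h => by
    rw [h, ENNReal.mul_top hε'] at h1
    simp at h1
  set c : ℝ≥0∞ := (H univ)⁻¹
  have hc0 : c ≠ 0 := ENNReal.inv_ne_zero.2 htop
  have hctop : c ≠ ⊤ := ENNReal.inv_ne_top.2 h0
  have hprob : IsProbabilityMeasure (c • H) :=
    ⟨by rw [Measure.smul_apply, smul_eq_mul, ENNReal.inv_mul_cancel h0 htop]⟩
  have hsupp : (c • H).support = S := by
    refine Subset.antisymm ?_ ?_
    · refine Measure.support_subset_of_isClosed hSc ?_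
      rw [mem_ae_iff, Measure.smul_apply, hH, Measure.restrict_apply hSc.measurableSet.compl]
      simp
    · refine Measure.AbsolutelyContinuous.support_mono
        (hac.trans (Measure.AbsolutelyContinuous.mk fun s _ hs => ?_))
      rw [Measure.smul_apply, smul_eq_mul, mul_eq_zero] at hs
      exact hs.resolve_left hc0
  obtain ⟨ν, hcoe⟩ : ∃ ν : ProbabilityMeasure (EuclideanSpace ℝ (Fin D)),
      (ν : Measure (EuclideanSpace ℝ (Fin D))) = c • H := ⟨⟨c • H, hprob⟩, rfl⟩
  refine ⟨ν, ?_, c, hctop, ?_⟩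
  · refine ⟨?_, ?_, ?_, fun _ => c, measurable_const, fun x _ => ?_, ?_⟩
    · rw [hcoe, hsupp]; exact hc
    · rw [hcoe, hsupp]; exact hsub
    · rw [hcoe, hsupp]; exact hr
    · exact ENNReal.le_inv_iff_mul_le.2 h1
    · rw [hcoe, hsupp, withDensity_const]
  · rw [hcoe, hsupp]

/-! ### Bump fields and their flows. -/

/-- The vector field which has direction `v` and speed `A`, plus a conical bump of slope `L` and
radius `ρ` at the point `p`. -/
noncomputable def bumpField {D : ℕ} (v : EuclideanSpace ℝ (Fin D)) (A L ρ : ℝ)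
    (p x : EuclideanSpace ℝ (Fin D)) : EuclideanSpace ℝ (Fin D) :=
  (A + L * max 0 (ρ - ‖x - p‖)) • v

section Flow

variable {D : ℕ} {f : EuclideanSpace ℝ (Fin D) → EuclideanSpace ℝ (Fin D)} {L : ℝ≥0} {M : ℝ}

theorem flow_zero (hf : f ∈ LipClass D L M) (x : EuclideanSpace ℝ (Fin D)) : flow f x 0 = x :=
  (flow_isSolution hf x).1

theorem flow_hasDerivAt (hf : f ∈ LipClass D L M) (x : EuclideanSpace ℝ (Fin D)) (t : ℝ) :
    HasDerivAt (flow f x) (f (flow f x t)) t :=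
  (flow_isSolution hf x).2 t

theorem flow_continuous (hf : f ∈ LipClass D L M) (x : EuclideanSpace ℝ (Fin D)) :
    Continuous (flow f x) :=
  continuous_iff_continuousAt.2 fun t => (flow_hasDerivAt hf x t).continuousAt

/-- Grönwall's inequality; needed for measurability of the observations in the initial values. -/
theorem flow_continuous_left (hf : f ∈ LipClass D L M) {t : ℝ} (ht : 0 ≤ t) :
    Continuous fun x => flow f x t := by
  refine (LipschitzWith.of_dist_le_mul (K := (Real.exp (L * t)).toNNReal) fun x y => ?_).continuous
  have := dist_le_of_trajectories_ODE (v := fun _ => f) (K := L) (a := 0) (b := t)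
    (fun _ => hf.1) (flow_continuous hf x).continuousOn
    (fun s _ => (flow_hasDerivAt hf x s).hasDerivWithinAt)
    (flow_continuous hf y).continuousOn
    (fun s _ => (flow_hasDerivAt hf y s).hasDerivWithinAt)
    (δ := dist x y) (by rw [flow_zero hf, flow_zero hf]) t (right_mem_Icc.2 ht)
  rw [sub_zero, mul_comm] at this
  rwa [Real.coe_toNNReal _ (Real.exp_pos _).le]

theorem flow_add (hf : f ∈ LipClass D L M) (x : EuclideanSpace ℝ (Fin D)) (s t : ℝ) :
    flow f x (s + t) = flow f (flow f x s) t := by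
  have : IsSolution f (flow f x s) (fun t => flow f x (s + t)) :=
    ⟨by simp, fun t => by
      have := (flow_hasDerivAt hf x (s + t)).comp_const_add s t
      exact this⟩
  exact congrFun (this.eq_flow hf) t

/-- While the field is constant along a half line in its own direction, so is the motion. -/
theorem flow_eq_line (hf : f ∈ LipClass D L M) {x w : EuclideanSpace ℝ (Fin D)}
    (h : ∀ t : ℝ, 0 ≤ t → f (x + t • w) = w) {t : ℝ} (ht : 0 ≤ t) : flow f x t = x + t • w := by
  have hd : ∀ s, HasDerivAt (fun s : ℝ => x + s • w) w s := fun s => by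
    simpa using ((hasDerivAt_id s).smul_const w).const_add x
  have := ODE_solution_unique_of_mem_Icc_right (v := fun _ => f) (s := fun _ => univ) (K := L)
    (a := 0) (b := t) (fun _ _ => hf.1.lipschitzOnWith) (flow_continuous hf x).continuousOn
    (fun s _ => (flow_hasDerivAt hf x s).hasDerivWithinAt) (fun _ _ => trivial)
    (g := fun s => x + s • w) (by fun_prop)
    (fun s hs => by rw [h s hs.1]; exact (hd s).hasDerivWithinAt) (fun _ _ => trivial)
    (by simp [flow_zero hf])
  exact this (right_mem_Icc.2 ht)

end Flow

section BumpField

variable {D : ℕ} {v : EuclideanSpace ℝ (Fin D)} {A ρ : ℝ} {L : ℝ≥0}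

theorem bumpField_mem_lipClass (hv : ‖v‖ = 1) (hA : 0 ≤ A) (hρ : 0 ≤ ρ) {M : ℝ}
    (hM : A + L * ρ ≤ M) (p : EuclideanSpace ℝ (Fin D)) :
    bumpField v A L ρ p ∈ LipClass D L M := by
  constructor
  · refine LipschitzWith.of_dist_le_mul fun x y => ?_
    rw [dist_eq_norm, bumpField, bumpField, ← sub_smul, norm_smul, hv, mul_one,
      add_sub_add_left_eq_sub, ← mul_sub, norm_mul, Real.norm_of_nonneg L.coe_nonneg, Real.norm_eq_abs]
    gcongr
    refine (abs_max_sub_max_le_max _ _ _ _).trans ?_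
    rw [sub_self, abs_zero, max_eq_right (abs_nonneg _), sub_sub_sub_cancel_left]
    refine (abs_norm_sub_norm_le _ _).trans ?_
    rw [sub_sub_sub_cancel_right, dist_comm, dist_eq_norm]
  · intro x
    rw [bumpField, norm_smul, hv, mul_one, Real.norm_of_nonneg (by positivity)]
    refine le_trans ?_ hM
    gcongr
    exact max_le hρ (by linarith [norm_nonneg (x - p)])

theorem bumpField_of_le {p x : EuclideanSpace ℝ (Fin D)} (h : ρ ≤ ‖x - p‖) :
    bumpField v A L ρ p x = A • v := by
  rw [bumpField, max_eq_left (by linarith), mul_zero, add_zero]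

theorem norm_bumpField_sub_le (hv : ‖v‖ = 1) (hρ : 0 ≤ ρ) (p x : EuclideanSpace ℝ (Fin D)) :
    ‖bumpField v A L ρ p x - A • v‖ ≤ L * ρ := by
  rw [bumpField, ← sub_smul, norm_smul, hv, mul_one, add_sub_cancel_left,
    Real.norm_of_nonneg (by positivity)]
  gcongr
  exact max_le hρ (by linarith [norm_nonneg (x - p)])

theorem norm_bumpField_sub_self (hv : ‖v‖ = 1) (hρ : 0 ≤ ρ) {p q : EuclideanSpace ℝ (Fin D)}
    (hpq : ρ ≤ ‖p - q‖) :
    ‖bumpField v A L ρ p p - bumpField v A L ρ q p‖ = L * ρ := by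
  rw [bumpField_of_le hpq, bumpField, ← sub_smul, norm_smul, hv, sub_self, norm_zero, sub_zero,
    max_eq_right hρ, add_sub_cancel_left, mul_one, Real.norm_of_nonneg (by positivity)]

/-- The velocity differs from `A • v` by at most `L * ρ`; integrate in time. For `t` of order `ρ`
this is of order `ρ ^ 2`. -/
theorem norm_flow_bumpField_sub_le (hv : ‖v‖ = 1) (hA : 0 ≤ A) (hρ : 0 ≤ ρ)
    (p x : EuclideanSpace ℝ (Fin D)) {t : ℝ} (ht : 0 ≤ t) :
    ‖flow (bumpField v A L ρ p) x t - (x + t • A • v)‖ ≤ L * ρ * t := by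
  have hf := bumpField_mem_lipClass (L := L) hv hA hρ le_rfl p
  have hd : ∀ s, HasDerivAt (fun s => flow (bumpField v A L ρ p) x s - (x + s • A • v))
      (bumpField v A L ρ p (flow (bumpField v A L ρ p) x s) - A • v) s := fun s => by
    have := ((hasDerivAt_id s).smul_const (A • v)).const_add x
    simp only [one_smul] at this
    exact (flow_hasDerivAt hf x s).sub this
  have := (convex_univ (𝕜 := ℝ) (E := ℝ)).norm_image_sub_le_of_norm_hasDerivWithin_le
    (fun s _ => (hd s).hasDerivWithinAt) (fun s _ => norm_bumpField_sub_le hv hρ p _)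
    (mem_univ 0) (mem_univ t)
  simpa [flow_zero hf, abs_of_nonneg ht] using this

/-- The motion along `bumpField` is monotone on a line: it passes through every point ahead. -/
theorem exists_flow_bumpField_eq (hv : ‖v‖ = 1) (hA : 0 < A) (hρ : 0 ≤ ρ)
    (p x : EuclideanSpace ℝ (Fin D)) {H : ℝ} (hH : 0 ≤ H) :
    ∃ t ∈ Icc 0 (H / A), flow (bumpField v A L ρ p) x t = x + H • v := by
  have hf := bumpField_mem_lipClass (L := L) hv hA.le hρ le_rfl p
  set y := flow (bumpField v A L ρ p) x
  have hy : ∀ t, HasDerivAt y ((A + L * max 0 (ρ - ‖y t - p‖)) • v) t := flow_hasDerivAt hf x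
  have hvv : inner ℝ v v = (1 : ℝ) := by rw [real_inner_self_eq_norm_sq, hv, one_pow]
  have hs : ∀ t, HasDerivAt (fun t => inner ℝ v (y t)) (A + L * max 0 (ρ - ‖y t - p‖)) t := by
    intro t
    have := (hasDerivAt_const t v).inner ℝ (hy t)
    simpa only [inner_smul_right, hvv, mul_one, inner_zero_left, add_zero] using this
  -- The component orthogonal to `v` does not move, so only the height along `v` has to be followed.
  have hline : ∀ t, y t - inner ℝ v (y t) • v = x - inner ℝ v x • v := by
    have hd : ∀ t, HasDerivAt (fun t => y t - inner ℝ v (y t) • v) 0 t := fun t => by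
      have := (hy t).sub ((hs t).smul_const v)
      rwa [sub_self] at this
    intro t
    have := is_const_of_deriv_eq_zero (fun t => (hd t).differentiableAt) (fun t => (hd t).deriv) t 0
    rwa [show y 0 = x from flow_zero hf x] at this
  have hT : 0 ≤ H / A := by positivity
  have hgrow : inner ℝ v x + H ≤ inner ℝ v (y (H / A)) := by
    have hmono : Monotone fun t => inner ℝ v (y t) - A * t := by
      refine monotone_of_hasDerivAt_nonneg (f' := fun t => L * max 0 (ρ - ‖y t - p‖)) (fun t => ?_)
        fun t => by positivity
      have := (hs t).sub ((hasDerivAt_id t).const_mul A)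
      rwa [mul_one, add_sub_cancel_left] at this
    have := hmono hT
    simp only [show y 0 = x from flow_zero hf x, mul_zero, sub_zero] at this
    rw [mul_div_cancel₀ _ hA.ne'] at this
    linarith
  have hc : ContinuousOn (fun t => inner ℝ v (y t)) (Icc 0 (H / A)) := fun t _ =>
    (hs t).continuousAt.continuousWithinAt
  obtain ⟨t, ht, hte⟩ := intermediate_value_Icc hT hc
    (show inner ℝ v x + H ∈ _ from ⟨by simp [show y 0 = x from flow_zero hf x, hH], hgrow⟩)
  refine ⟨t, ht, ?_⟩
  have := hline t
  simp only at hte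
  rw [hte, sub_eq_iff_eq_add] at this
  rw [this, add_smul]
  abel

/-- Two bumps which are mirror images of each other delay the motion by the same amount: past both
of them, the flows agree. -/
theorem flow_bumpField_eq_of_le (hv : ‖v‖ = 1) (hA : 0 < A) (hρ : 0 ≤ ρ)
    {q x : EuclideanSpace ℝ (Fin D)} (hx : inner ℝ v (x - q) ≤ -(2 * ρ)) {t : ℝ}
    (ht : 2 * -inner ℝ v (x - q) / A ≤ t) :
    flow (bumpField v A L ρ (q + ρ • v)) x t = flow (bumpField v A L ρ (q - ρ • v)) x t := by
  have hf := bumpField_mem_lipClass (L := L) hv hA.le hρ le_rfl (q + ρ • v)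
  have hg := bumpField_mem_lipClass (L := L) hv hA.le hρ le_rfl (q - ρ • v)
  set H : ℝ := 2 * -inner ℝ v (x - q) with hH
  have hvv : inner ℝ v v = (1 : ℝ) := by rw [real_inner_self_eq_norm_sq, hv, one_pow]
  obtain ⟨s, hs, hys⟩ := exists_flow_bumpField_eq (L := L) hv hA hρ (q + ρ • v) x
    (H := H) (by linarith)
  set y := flow (bumpField v A L ρ (q + ρ • v)) x with hy
  let R := (Submodule.span ℝ {v})ᗮ.reflection
  have hRv : R v = -v := Submodule.reflection_orthogonalComplement_singleton_eq_neg v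
  have hRx : ∀ w, R w = w - (2 * inner ℝ v w) • v := fun w => by
    simp only [R, Submodule.reflection_orthogonal_apply, Submodule.reflection_singleton_apply, hv,
      RCLike.ofReal_real_eq_id, id_eq, one_pow, div_one]
    module
  -- Reflection in the hyperplane through `q` orthogonal to `v` exchanges the cones and reverses
  -- `v`; reversing time restores the direction. Here `s` is the time at which `y` reaches the
  -- mirror image `x + H • v` of `x`, so the reflected reversed path starts at `x` and is at `x + H
  -- • v` at time `s`.
  have hz : IsSolution (bumpField v A L ρ (q - ρ • v)) x fun r => q + R (y (s - r) - q) := by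
    refine ⟨?_, fun r => ?_⟩
    · simp only [sub_zero, hys, hRx]
      rw [show x + H • v - q = (x - q) + H • v by abel, inner_add_right, inner_smul_right, hvv, hH]
      module
    · have h1 := ((flow_hasDerivAt hf x (s - r)).comp_const_sub s r).sub_const q
      have h2 := ((R.toContinuousLinearEquiv.hasFDerivAt.comp_hasDerivAt r h1).const_add q)
      have h3 : ‖q + R (y (s - r) - q) - (q - ρ • v)‖ = ‖y (s - r) - (q + ρ • v)‖ := by
        rw [← R.norm_map (y (s - r) - (q + ρ • v)), ← sub_sub, map_sub R (y (s - r) - q),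
          map_smul, hRv]
        congr 1
        module
      have h4 : HasDerivAt (fun r => q + R (y (s - r) - q))
          (R (-bumpField v A L ρ (q + ρ • v) (y (s - r)))) r := h2
      rw [map_neg, bumpField, map_smul, hRv, smul_neg, neg_neg] at h4
      simpa only [bumpField, h3] using h4
  have hzs : flow (bumpField v A L ρ (q - ρ • v)) x s = y s := by
    rw [← hz.eq_flow hg, hys]
    simp only [sub_self, show y 0 = x from flow_zero hf x, hRx, hH]
    module
  have ht' : 0 ≤ t - s := by linarith [hs.2]
  have htail : ∀ r : ℝ, 0 ≤ r → 2 * ρ ≤ inner ℝ v (x + H • v + r • A • v - q) := fun r hr => by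
    rw [show x + H • v + r • A • v - q = (x - q) + (H + r * A) • v by module, inner_add_right,
      inner_smul_right, hvv, hH]
    nlinarith [mul_nonneg hr hA.le]
  -- From `x + H • v` on, the height above `q` is at least `2 * ρ`, beyond both cones, and both
  -- motions are uniform.
  have hfar : ∀ (c : ℝ) (z : EuclideanSpace ℝ (Fin D)), |c| ≤ ρ → 2 * ρ ≤ inner ℝ v (z - q) →
      ρ ≤ ‖z - (q + c • v)‖ := fun c z hc hz => by
    have h1 := real_inner_le_norm v (z - (q + c • v))
    rw [hv, one_mul, ← sub_sub, inner_sub_right, inner_smul_right, hvv] at h1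
    rw [← sub_sub]
    linarith [le_abs_self c]
  have e1 : flow (bumpField v A L ρ (q + ρ • v)) (x + H • v) (t - s) =
      x + H • v + (t - s) • A • v :=
    flow_eq_line hf (fun r hr => bumpField_of_le
      (hfar ρ _ (abs_of_nonneg hρ).le (htail r hr))) ht'
  have e2 : flow (bumpField v A L ρ (q - ρ • v)) (x + H • v) (t - s) =
      x + H • v + (t - s) • A • v :=
    flow_eq_line hg (fun r hr => bumpField_of_le (by
      have := hfar (-ρ) _ (by rw [abs_neg, abs_of_nonneg hρ]) (htail r hr)
      rwa [neg_smul, ← sub_eq_add_neg] at this)) ht'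
  rw [show t = s + (t - s) by ring, hy, flow_add hf, flow_add hg, hzs]
  simp only [← hy]
  rw [hys, e1, e2]

/-- A ray entering a cone would do so within length `4 * ρ` of the height of its centre, which would
put `x` within `5 * ρ` of `q`. Hence the ray stays where both fields equal `A • v`. -/
theorem flow_bumpField_eq_of_far (hv : ‖v‖ = 1) (hA : 0 < A) (hρ : 0 ≤ ρ)
    {q x : EuclideanSpace ℝ (Fin D)} (hx : -(3 * ρ) ≤ inner ℝ v (x - q))
    (hfar : 7 * ρ < ‖x - q‖) {t : ℝ} (ht : 0 ≤ t) :
    flow (bumpField v A L ρ (q + ρ • v)) x t = flow (bumpField v A L ρ (q - ρ • v)) x t := by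
  have hvv : inner ℝ v v = (1 : ℝ) := by rw [real_inner_self_eq_norm_sq, hv, one_pow]
  have key : ∀ c : ℝ, |c| ≤ ρ → ∀ r : ℝ, 0 ≤ r → ρ ≤ ‖x + r • A • v - (q + c • v)‖ := by
    intro c hc r hr
    by_contra! h
    have h1 := (le_abs_self _).trans (abs_real_inner_le_norm v (x + r • A • v - (q + c • v)))
    have e : x + r • A • v - (q + c • v) = (x - q) + (r * A - c) • v := by module
    rw [e] at h h1
    rw [inner_add_right, inner_smul_right, hvv, hv] at h1
    have h2 : ‖x - q‖ ≤ ‖(x - q) + (r * A - c) • v‖ + |r * A - c| := by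
      have := norm_sub_le ((x - q) + (r * A - c) • v) ((r * A - c) • v)
      rwa [add_sub_cancel_right, norm_smul, hv, mul_one, Real.norm_eq_abs] at this
    have hc' := abs_le.1 hc
    have h3 : |r * A - c| ≤ 4 * ρ :=
      abs_le.2 ⟨by linarith [mul_nonneg hr hA.le], by linarith⟩
    linarith
  have hf := bumpField_mem_lipClass (L := L) hv hA.le hρ le_rfl (q + ρ • v)
  have hg := bumpField_mem_lipClass (L := L) hv hA.le hρ le_rfl (q - ρ • v)
  rw [flow_eq_line hf (fun r hr => bumpField_of_le (key ρ (abs_of_nonneg hρ).le r hr)) ht,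
    flow_eq_line hg (fun r hr => bumpField_of_le (by
      have := key (-ρ) (by rw [abs_neg, abs_of_nonneg hρ]) r hr
      rwa [neg_smul, ← sub_eq_add_neg] at this)) ht]

end BumpField

/-! ### Observation times, information and risk. -/

theorem gridTime_nonneg {T : ℝ} (hT : 0 ≤ T) {m : ℕ} (j : Fin m) : 0 ≤ gridTime T m j := by
  unfold gridTime; positivity

/-- The grid starts at `T / m` rather than `0`, so no additive `1` appears: the count is zero when
`s * m < T`, which is what produces the rate `1 / m`. -/
theorem card_gridTime_le {T s : ℝ} (hT : 0 < T) (hs : 0 ≤ s) (m : ℕ) :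
    (({j : Fin m | gridTime T m j ≤ s} : Finset (Fin m)).card : ℝ) ≤ s * m / T := by
  have h0 : 0 ≤ s * m / T := by positivity
  rw [← Nat.le_floor_iff h0]
  refine (Finset.card_le_card_of_injOn (t := Finset.range ⌊s * m / T⌋₊) Fin.val
    (fun j hj => ?_) Fin.val_injective.injOn).trans_eq (Finset.card_range _)
  have hm : (0 : ℝ) < m := by exact_mod_cast (Nat.zero_le _).trans_lt j.2
  replace hj : ((j : ℕ) + 1 : ℝ) * T / m ≤ s := (Finset.mem_filter.1 hj).2
  rw [Finset.coe_range, mem_Iio, ← Nat.succ_le_iff, Nat.le_floor_iff h0, le_div_iff₀ hT]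
  rw [div_le_iff₀ hm] at hj
  push_cast
  exact hj

theorem measurable_observe {D n m : ℕ} {L : ℝ≥0} {M T σ : ℝ} (hT : 0 ≤ T)
    {f : EuclideanSpace ℝ (Fin D) → EuclideanSpace ℝ (Fin D)} (hf : f ∈ LipClass D L M) :
    Measurable (observe f T σ : Data D n m → Data D n m) := by
  refine measurable_fst.prodMk (measurable_pi_lambda _ fun i => measurable_pi_lambda _ fun j => ?_)
  have h1 : Measurable fun x => flow f x (gridTime T m j) :=
    (flow_continuous_left hf (gridTime_nonneg hT j)).measurable
  have h2 : Measurable fun w : Data D n m => w.2 i j := by fun_prop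
  exact (h1.comp ((measurable_pi_apply i).comp measurable_fst)).add (h2.const_smul σ)

/-- Weierstrass' product inequality, a union bound in the form `∏ a ≥ 1 - ∑ (1 - a)`. -/
theorem one_le_prod_add_sum {ι : Type*} (s : Finset ι) {a : ι → ℝ} (h0 : ∀ i ∈ s, 0 ≤ a i)
    (h1 : ∀ i ∈ s, a i ≤ 1) : 1 ≤ ∏ i ∈ s, a i + ∑ i ∈ s, (1 - a i) := by
  classical
  induction s using Finset.induction_on with
  | empty => simp
  | insert i s hi ih =>
    rw [Finset.prod_insert hi, Finset.sum_insert hi]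
    have h2 := ih (fun j hj => h0 j (Finset.mem_insert_of_mem hj))
      fun j hj => h1 j (Finset.mem_insert_of_mem hj)
    have h3 : ∏ j ∈ s, a j ≤ 1 := Finset.prod_le_one
      (fun j hj => h0 j (Finset.mem_insert_of_mem hj))
      fun j hj => h1 j (Finset.mem_insert_of_mem hj)
    nlinarith [h0 i (Finset.mem_insert_self i s), h1 i (Finset.mem_insert_self i s)]

/-- By the product inequality, each sample point costs at most `μ B * (1 - exp (-Q / 2))`. Keeping
this product covers at once few points in `B`, small `Q`, and `Q = 0`. -/
theorem half_le_lintegral_exp {X : Type*} [MeasurableSpace X] {μ : Measure X}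
    [IsProbabilityMeasure μ] {n : ℕ} {B : Set X} (hB : MeasurableSet B) {Q b : ℝ}
    (hQ : 0 ≤ Q) (hμB : μ B ≤ ENNReal.ofReal b)
    (hnb : n * b * (1 - Real.exp (-(Q / 2))) ≤ 1 / 2) {q : X → ℝ}
    (hq : ∀ᵐ x ∂μ, 0 ≤ q x ∧ q x ≤ B.indicator (fun _ => Q) x) :
    1 / 2 ≤ ∫⁻ x : Fin n → X, ENNReal.ofReal (Real.exp (-((∑ i, q (x i)) / 2)))
      ∂Measure.pi fun _ => μ := by
  set c : ℝ := 1 - Real.exp (-(Q / 2))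
  have hc : 0 ≤ c := by
    have : Real.exp (-(Q / 2)) ≤ 1 := Real.exp_le_one_iff.2 (by linarith)
    simp only [c]; linarith
  have hae : ∀ᵐ x ∂Measure.pi fun _ : Fin n => μ, ∀ i,
      0 ≤ q (x i) ∧ q (x i) ≤ B.indicator (fun _ => Q) (x i) :=
    ae_all_iff.2 fun i =>
      (measurePreserving_eval (fun _ : Fin n => μ) i).quasiMeasurePreserving.ae hq
  have hm : Measurable fun x => B.indicator (fun _ => ENNReal.ofReal c) x :=
    measurable_const.indicator hB
  have hmi : ∀ i : Fin n,
      Measurable fun x : Fin n → X => B.indicator (fun _ => ENNReal.ofReal c) (x i) := fun i =>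
    hm.comp (measurable_pi_apply i)
  have h1 : (1 : ℝ≥0∞) ≤ ∫⁻ x : Fin n → X, ENNReal.ofReal (Real.exp (-((∑ i, q (x i)) / 2)))
      ∂(Measure.pi fun _ => μ) +
      ∫⁻ x : Fin n → X, ∑ i, B.indicator (fun _ => ENNReal.ofReal c) (x i)
      ∂(Measure.pi fun _ => μ) := by
    rw [← lintegral_add_right _ (Finset.measurable_sum _ fun i _ => hmi i),
      ← measure_univ (μ := Measure.pi fun _ : Fin n => μ), ← lintegral_one]
    refine lintegral_mono_ae ?_
    filter_upwards [hae] with x hx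
    have h2 := one_le_prod_add_sum Finset.univ (a := fun i => Real.exp (-(q (x i) / 2)))
      (fun i _ => (Real.exp_pos _).le) fun i _ => Real.exp_le_one_iff.2 (by linarith [(hx i).1])
    rw [← Real.exp_sum, Finset.sum_neg_distrib, ← Finset.sum_div] at h2
    have h3 : ∀ i, ENNReal.ofReal (1 - Real.exp (-(q (x i) / 2))) ≤
        B.indicator (fun _ => ENNReal.ofReal c) (x i) := fun i => by
      by_cases hi : x i ∈ B
      · rw [indicator_of_mem hi]
        have := (hx i).2
        rw [indicator_of_mem hi] at this
        refine ENNReal.ofReal_le_ofReal ?_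
        simp only [c]
        gcongr
      · have := hx i
        rw [indicator_of_notMem hi] at this
        rw [indicator_of_notMem hi, le_antisymm this.2 this.1]
        simp
    calc (1 : ℝ≥0∞) = ENNReal.ofReal 1 := ENNReal.ofReal_one.symm
      _ ≤ _ := ENNReal.ofReal_le_ofReal h2
      _ ≤ _ := ENNReal.ofReal_add_le
      _ ≤ _ := by
        gcongr
        rw [ENNReal.ofReal_sum_of_nonneg fun i _ => sub_nonneg.2
          (Real.exp_le_one_iff.2 (by linarith [(hx i).1]))]
        exact Finset.sum_le_sum fun i _ => h3 i
  have h2 : ∫⁻ x : Fin n → X, ∑ i, B.indicator (fun _ => ENNReal.ofReal c) (x i)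
      ∂(Measure.pi fun _ => μ) ≤ 1 / 2 := by
    rw [lintegral_finsetSum _ fun i _ => hmi i]
    have h3 : ∀ i : Fin n, ∫⁻ x : Fin n → X, B.indicator (fun _ => ENNReal.ofReal c) (x i)
        ∂(Measure.pi fun _ => μ) = ENNReal.ofReal c * μ B := fun i => by
      rw [(measurePreserving_eval (fun _ : Fin n => μ) i).lintegral_comp hm,
        lintegral_indicator_const hB]
    simp only [h3, Finset.sum_const, Finset.card_univ, Fintype.card_fin, nsmul_eq_mul]
    calc (n : ℝ≥0∞) * (ENNReal.ofReal c * μ B)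
        ≤ ENNReal.ofReal n * (ENNReal.ofReal c * ENNReal.ofReal b) := by
          rw [ENNReal.ofReal_natCast]; gcongr
      _ = ENNReal.ofReal (n * b * c) := by
          rw [← ENNReal.ofReal_mul hc, ← ENNReal.ofReal_mul (by positivity)]
          congr 1; ring
      _ ≤ ENNReal.ofReal (1 / 2) := ENNReal.ofReal_le_ofReal hnb
      _ = 1 / 2 := by rw [ENNReal.ofReal_div_of_pos (by norm_num)]; simp
  have h3 : (1 : ℝ≥0∞) - 1 / 2 ≤ _ := tsub_le_iff_right.2 (h1.trans (add_le_add_right h2 _))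
  rwa [one_div, ENNReal.one_sub_inv_two, ← one_div] at h3

/-- Two vector fields whose flows agree at the observation times, except for a small amount on a
set of small probability, cannot be told apart by an estimator. -/
theorem le_pointwiseRisk_add {D n m : ℕ} {L : ℝ≥0} {M T σ : ℝ} (hT : 0 ≤ T) (hσ : 0 < σ)
    {f g : EuclideanSpace ℝ (Fin D) → EuclideanSpace ℝ (Fin D)} (hf : f ∈ LipClass D L M)
    (hg : g ∈ LipClass D L M) {μ : Measure (EuclideanSpace ℝ (Fin D))} [IsProbabilityMeasure μ]
    {B : Set (EuclideanSpace ℝ (Fin D))} (hB : MeasurableSet B) {Q b : ℝ} (hQ : 0 ≤ Q)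
    (hμB : μ B ≤ ENNReal.ofReal b) (hnb : n * b * (1 - Real.exp (-(Q / 2))) ≤ 1 / 2)
    (hfg : ∀ᵐ x ∂μ, ∑ j : Fin m, ‖σ⁻¹ • (flow f x (gridTime T m j) - flow g x (gridTime T m j))‖ ^ 2
      ≤ B.indicator (fun _ => Q) x)
    {e : Data D n m → EuclideanSpace ℝ (Fin D) → EuclideanSpace ℝ (Fin D)} (he : IsEstimator e)
    (y : EuclideanSpace ℝ (Fin D)) :
    ‖f y - g y‖ₑ / 4 ≤ pointwiseRisk T σ e f μ y + pointwiseRisk T σ e g μ y := by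
  have hF : ∀ k, k ∈ LipClass D L M → ∀ z, Measurable fun w => ‖e (observe k T σ w) y - z‖ₑ :=
    fun k hk z => (((he y).comp (measurable_observe hT hk)).sub_const _).enorm
  set q : EuclideanSpace ℝ (Fin D) → ℝ := fun x =>
    ∑ j : Fin m, ‖σ⁻¹ • (flow f x (gridTime T m j) - flow g x (gridTime T m j))‖ ^ 2 with hq
  have hq0 : ∀ x, 0 ≤ q x := fun x => Finset.sum_nonneg fun _ _ => by positivity
  have hhalf := half_le_lintegral_exp (n := n) hB hQ hμB hnb (q := q)
    (hfg.mono fun x hx => ⟨hq0 x, hx⟩)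
  unfold pointwiseRisk designLaw
  rw [lintegral_prod _ (hF f hf _).aemeasurable, lintegral_prod _ (hF g hg _).aemeasurable,
    ← lintegral_add_left (hF f hf _).lintegral_prod_right']
  -- One factor `1 / 2` comes from the event `{0 ≤ ℓ}`, conditionally on the initial values, the
  -- other from averaging over them.
  calc ‖f y - g y‖ₑ / 4 = ‖f y - g y‖ₑ / 2 * (1 / 2) := by
        rw [div_eq_mul_inv, div_eq_mul_inv, one_div, mul_assoc,
          ← ENNReal.mul_inv (by simp) (by simp)]
        norm_num
    _ ≤ ‖f y - g y‖ₑ / 2 * ∫⁻ x : Fin n → EuclideanSpace ℝ (Fin D),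
        ENNReal.ofReal (Real.exp (-((∑ i, q (x i)) / 2))) ∂Measure.pi fun _ => μ := by gcongr
    _ = ∫⁻ x : Fin n → EuclideanSpace ℝ (Fin D), ‖f y - g y‖ₑ / 2 *
        ENNReal.ofReal (Real.exp (-((∑ i, q (x i)) / 2))) ∂Measure.pi fun _ => μ := by
      rw [lintegral_const_mul' _ _ (ENNReal.div_ne_top (by simp) (by simp))]
    _ ≤ _ := lintegral_mono fun x => ?_
  let h : Fin n → Fin m → EuclideanSpace ℝ (Fin D) := fun i j =>
    σ⁻¹ • (flow f (x i) (gridTime T m j) - flow g (x i) (gridTime T m j))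
  choose ℓ hℓ using fun u : EuclideanSpace ℝ (Fin D) => gaussianShift_stdGaussian u
  have H : GaussianShift _ h _ _ := GaussianShift.pi fun i => GaussianShift.pi fun j => hℓ (h i j)
  have := H.le_lintegral_add (Δ := ‖f y - g y‖ₑ)
    (F := fun ξ => ‖e (observe g T σ (x, ξ)) y - f y‖ₑ)
    (G := fun ξ => ‖e (observe g T σ (x, ξ)) y - g y‖ₑ)
    (Finset.sum_nonneg fun i _ => hq0 (x i))
    ((hF g hg _).comp measurable_prodMk_left) ((hF g hg _).comp measurable_prodMk_left)
    (fun ξ => by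
      rw [← edist_eq_enorm_sub, ← edist_eq_enorm_sub, ← edist_eq_enorm_sub, edist_comm _ (f y)]
      exact edist_triangle _ _ _)
  -- Given the initial values, passing from `g` to `f` amounts to translating the noise by `h`.
  have hobs : ∀ ξ, observe g T σ (x, ξ + h) = observe f T σ (x, ξ) := fun ξ => by
    refine Prod.ext rfl ?_
    ext1 i
    ext1 j
    simp only [observe, Pi.add_apply, h, smul_add, smul_inv_smul₀ hσ.ne']
    abel
  simp only [hobs] at this
  refine le_trans (le_of_eq ?_) this
  rw [ENNReal.div_eq_inv_mul, ENNReal.div_eq_inv_mul, mul_assoc]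

theorem le_minimaxPointwiseRisk {D d n m : ℕ} {L : ℝ≥0} {M τ ε T σ : ℝ} {r : ℝ≥0∞}
    {f g : EuclideanSpace ℝ (Fin D) → EuclideanSpace ℝ (Fin D)} (hf : f ∈ LipClass D L M)
    (hg : g ∈ LipClass D L M) {μ : ProbabilityMeasure (EuclideanSpace ℝ (Fin D))}
    (hμ : μ ∈ ManifoldClass D d τ ε) {y : EuclideanSpace ℝ (Fin D)}
    (hyf : y ∈ Env f (μ : Measure (EuclideanSpace ℝ (Fin D))).support T)
    (hyg : y ∈ Env g (μ : Measure (EuclideanSpace ℝ (Fin D))).support T)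
    (h : ∀ e : Data D n m → EuclideanSpace ℝ (Fin D) → EuclideanSpace ℝ (Fin D), IsEstimator e →
      2 * r ≤ pointwiseRisk T σ e f μ y + pointwiseRisk T σ e g μ y) :
    r ≤ minimaxPointwiseRisk D d L M τ ε T σ n m := by
  refine le_iInf₂ fun e he => ?_
  set R := ⨆ (f ∈ LipClass D L M) (μ ∈ ManifoldClass D d τ ε)
      (x ∈ Env f (μ : Measure (EuclideanSpace ℝ (Fin D))).support T),
      pointwiseRisk T σ e f (μ : Measure (EuclideanSpace ℝ (Fin D))) x
  have key : ∀ k, k ∈ LipClass D L M →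
      y ∈ Env k (μ : Measure (EuclideanSpace ℝ (Fin D))).support T →
      pointwiseRisk T σ e k μ y ≤ R := fun k hk hy =>
    le_iSup₂_of_le k hk (le_iSup₂_of_le μ hμ (le_iSup₂_of_le y hy le_rfl))
  have h2 := (h e he).trans (add_le_add (key f hf hyf) (key g hg hyg))
  rw [← two_mul] at h2
  exact (ENNReal.mul_le_mul_iff_right (by simp) (by simp)).1 h2

/-! ### The two hypotheses at scale `ρ`. -/

/-- The two point bound, at every small scale `ρ` at which the data carry little information. -/
theorem exists_le_minimaxPointwiseRisk_of_scale (D d : ℕ) (hd : 1 ≤ d) (L : ℝ≥0) (M : ℝ)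
    (hM : 0 < M) (τ : ℝ) (ε : ℝ) (hε : 0 < ε) (T : ℝ) (hT : 0 < T) (σ : ℝ)
    (hσ : 0 < σ) (hne : (ManifoldClass D d τ ε).Nonempty) :
    ∃ C₁ C₂ C₃ ρ₀ : ℝ, 0 ≤ C₁ ∧ 0 ≤ C₂ ∧ 0 < C₃ ∧ 0 < ρ₀ ∧ ∀ ρ, 0 < ρ → ρ ≤ ρ₀ → ∀ n m : ℕ,
      (n * (C₁ * ρ ^ d) ≤ 1 / 2 ∨ n * (C₁ * ρ ^ d) * (C₂ * (m * ρ ^ 5)) ≤ 1 / 2 ∨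
        C₃ * ρ * m < 1) →
      ENNReal.ofReal (L * ρ / 8) ≤ minimaxPointwiseRisk D d L M τ ε T σ n m := by
  obtain ⟨μ, hμ, c, hc, hunif⟩ := exists_uniform_mem_manifoldClass hε hne
  set S := (μ : Measure (EuclideanSpace ℝ (Fin D))).support with hS
  have hcomp : IsCompact S := hμ.1
  have hsub : IsSubmanifold d S := hμ.2.1
  have hD : 0 < D := hd.trans hsub.1
  obtain ⟨v, hv⟩ : ∃ v : EuclideanSpace ℝ (Fin D), ‖v‖ = 1 :=
    ⟨EuclideanSpace.single ⟨0, hD⟩ 1, by simp⟩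
  have hvv : inner ℝ v v = (1 : ℝ) := by rw [real_inner_self_eq_norm_sq, hv, one_pow]
  have hSne : S.Nonempty := Measure.nonempty_support (IsProbabilityMeasure.ne_zero _)
  obtain ⟨p, hp, hmin⟩ := hcomp.exists_isMinOn hSne
    (f := fun x => inner ℝ v x) (by fun_prop : Continuous _).continuousOn
  have hmin : ∀ x ∈ S, inner ℝ v p ≤ inner ℝ v x := fun x hx => hmin hx
  obtain ⟨C, hC, hCr⟩ := hsub.exists_measure_closedBall_le hp
  -- With slope `1 / 10`, points of `S` within `10 * ρ` of `p` have height at most `ρ` above `p`,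
  -- hence lie at least `2 * ρ` below `q`.
  have hflat := hsub.eventually_inner_le hp hmin (η := 1 / 10) (by norm_num)
  obtain ⟨r₀, hr₀, hflat⟩ := Metric.nhds_basis_closedBall.mem_iff.1 hflat
  obtain ⟨r₁, hr₁, hCr⟩ := (mem_nhdsGT_iff_exists_Ioc_subset).1 hCr
  have hr₁ : 0 < r₁ := hr₁
  set A : ℝ := M / 2 with hAdef
  have hA : 0 < A := by positivity
  have hL1 : 0 < (L : ℝ) + 1 := by positivity
  set κ : ℝ := (σ⁻¹ * (2 * L * (6 / A))) ^ 2 with hκ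
  -- The bounds on `ρ` ensure, in order: flatness and the volume bound on the ball of radius `10 *
  -- ρ`, speed at most `A + L * ρ ≤ M`, and arrival at `p + (4 * ρ) • v` before time `T`.
  refine ⟨c.toReal * (C * 10 ^ d), 6 / (A * T) * κ, 6 / (A * T),
    min (min (r₀ / 10) (r₁ / 10)) (min (A / (L + 1)) (T * A / 4)), by positivity, by positivity,
    by positivity, by positivity, fun ρ hρ hρ₀ n m hnm => ?_⟩
  simp only [le_min_iff] at hρ₀
  obtain ⟨⟨hρr₀, hρr₁⟩, hρL, hρT⟩ := hρ₀
  rw [le_div_iff₀ (by positivity)] at hρr₀ hρr₁ hρL hρT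
  have hLρ : A + L * ρ ≤ M := by
    have : A + A = M := by rw [hAdef]; ring
    nlinarith
  set q := p + (3 * ρ) • v with hq
  have hf := bumpField_mem_lipClass (L := L) hv hA.le hρ.le hLρ (q + ρ • v)
  have hg := bumpField_mem_lipClass (L := L) hv hA.le hρ.le hLρ (q - ρ • v)
  set f := bumpField v A L ρ (q + ρ • v) with hfdef
  set g := bumpField v A L ρ (q - ρ • v) with hgdef
  set B := Metric.closedBall p (10 * ρ) with hBdef
  -- The test point `q + ρ • v = p + (4 * ρ) • v` is on the trajectory of `p` whatever the position
  -- of the cone.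
  have hEnv : ∀ p', q + ρ • v ∈ Env (bumpField v A L ρ p') S T := fun p' => by
    obtain ⟨t, ht, hte⟩ := exists_flow_bumpField_eq (L := L) hv hA hρ.le p' p
      (H := 4 * ρ) (by positivity)
    refine ⟨p, hp, t, ⟨ht.1, ht.2.trans ?_⟩, ?_⟩
    · rw [div_le_iff₀ hA]; linarith
    · rw [hte, hq]; module
  have hiq : ∀ x, inner ℝ v (x - q) = inner ℝ v (x - p) - 3 * ρ := fun x => by
    rw [hq, ← sub_sub, inner_sub_right, inner_smul_right, hvv, mul_one]
  have hip : ∀ x ∈ S, 0 ≤ inner ℝ v (x - p) := fun x hx => by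
    rw [inner_sub_right]; linarith [hmin x hx]
  have hagree : ∀ x ∈ S, x ∉ B → ∀ t, 0 ≤ t → flow f x t = flow g x t := by
    intro x hx hxB t ht
    refine flow_bumpField_eq_of_far hv hA hρ.le (by linarith [hiq x, hip x hx]) ?_ ht
    rw [hBdef, Metric.mem_closedBall, not_le, dist_eq_norm] at hxB
    have := norm_sub_norm_le (x - p) ((3 * ρ) • v)
    rw [norm_smul, hv, mul_one, Real.norm_of_nonneg (by positivity)] at this
    rw [hq, ← sub_sub]
    linarith
  have hagree' : ∀ x ∈ S, x ∈ B → ∀ t, 6 * ρ / A ≤ t → flow f x t = flow g x t := by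
    intro x hx hxB t ht
    have h1 : inner ℝ v (x - p) ≤ 1 / 10 * ‖x - p‖ :=
      hflat (Metric.closedBall_subset_closedBall (by linarith) hxB) hx
    rw [hBdef, Metric.mem_closedBall, dist_eq_norm] at hxB
    refine flow_bumpField_eq_of_le hv hA hρ.le (by linarith [hiq x]) (le_trans ?_ ht)
    refine div_le_div_of_nonneg_right ?_ hA.le
    linarith [hiq x, hip x hx]
  have hclose : ∀ x t, 0 ≤ t → t ≤ 6 * ρ / A →
      ‖σ⁻¹ • (flow f x t - flow g x t)‖ ^ 2 ≤ κ * ρ ^ 4 := by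
    intro x t ht ht'
    have h1 := norm_flow_bumpField_sub_le (L := L) hv hA.le hρ.le (q + ρ • v) x ht
    have h2 := norm_flow_bumpField_sub_le (L := L) hv hA.le hρ.le (q - ρ • v) x ht
    have h3 : ‖flow f x t - flow g x t‖ ≤ 2 * L * ρ * t := by
      rw [← sub_sub_sub_cancel_right _ _ (x + t • A • v)]
      refine (norm_sub_le _ _).trans ?_
      linarith
    rw [norm_smul, Real.norm_of_nonneg (by positivity)]
    calc (σ⁻¹ * ‖flow f x t - flow g x t‖) ^ 2 ≤ (σ⁻¹ * (2 * L * ρ * (6 * ρ / A))) ^ 2 := by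
          gcongr
          exact h3.trans (by gcongr)
      _ = κ * ρ ^ 4 := by rw [hκ]; ring
  set J : Finset (Fin m) := {j : Fin m | gridTime T m j ≤ 6 * ρ / A} with hJ
  have hJcard : (J.card : ℝ) ≤ 6 / (A * T) * (ρ * m) := by
    refine (card_gridTime_le hT (by positivity) m).trans_eq ?_
    ring
  set Q : ℝ := J.card * (κ * ρ ^ 4) with hQdef
  have hQ : 0 ≤ Q := mul_nonneg (Nat.cast_nonneg _) (by positivity)
  have hsum : ∀ᵐ x ∂(μ : Measure (EuclideanSpace ℝ (Fin D))),
      ∑ j : Fin m, ‖σ⁻¹ • (flow f x (gridTime T m j) - flow g x (gridTime T m j))‖ ^ 2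
        ≤ B.indicator (fun _ => Q) x := by
    filter_upwards [Measure.support_mem_ae (μ := (μ : Measure (EuclideanSpace ℝ (Fin D))))]
      with x hx
    by_cases hxB : x ∈ B
    · rw [indicator_of_mem hxB, hQdef, ← nsmul_eq_mul, ← Finset.sum_const, hJ, Finset.sum_filter]
      refine Finset.sum_le_sum fun j _ => ?_
      split_ifs with hj
      · exact hclose x _ (gridTime_nonneg hT.le j) hj
      · rw [hagree' x hx hxB _ (not_le.1 hj).le]
        simp
    · rw [indicator_of_notMem hxB]
      refine (Finset.sum_eq_zero fun j _ => ?_).le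
      rw [hagree x hx hxB _ (gridTime_nonneg hT.le j)]
      simp
  have hμB : (μ : Measure (EuclideanSpace ℝ (Fin D))) B ≤
      ENNReal.ofReal (c.toReal * (C * 10 ^ d) * ρ ^ d) := by
    rw [hunif, Measure.smul_apply, Measure.restrict_apply Metric.isClosed_closedBall.measurableSet,
      inter_comm, smul_eq_mul]
    calc c * _ ≤ ENNReal.ofReal c.toReal * ENNReal.ofReal (C * (10 * ρ) ^ d) := by
          rw [ENNReal.ofReal_toReal hc]
          gcongr
          exact hCr ⟨by positivity, by linarith⟩
      _ = _ := by
          rw [← ENNReal.ofReal_mul (by positivity), mul_pow]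
          congr 1
          ring
  set b : ℝ := c.toReal * (C * 10 ^ d) * ρ ^ d with hbdef
  have hb : 0 ≤ b := by positivity
  have hnb : n * b * (1 - Real.exp (-(Q / 2))) ≤ 1 / 2 := by
    have h1 : 1 - Real.exp (-(Q / 2)) ≤ Q / 2 := by linarith [Real.add_one_le_exp (-(Q / 2))]
    have h2 : 0 ≤ n * b := by positivity
    -- The factor `1 - exp (-Q / 2)` is bounded by `1`, by `Q`, or vanishes because no grid time
    -- falls in the crossing.
    rcases hnm with h | h | h
    · nlinarith [Real.exp_pos (-(Q / 2))]
    · refine le_trans (mul_le_mul_of_nonneg_left ?_ h2) h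
      refine h1.trans ((half_le_self hQ).trans ?_)
      calc Q ≤ 6 / (A * T) * (ρ * m) * (κ * ρ ^ 4) := by rw [hQdef]; gcongr
        _ = _ := by ring
    · have h3 : (J.card : ℝ) < 1 := hJcard.trans_lt (by linarith)
      have h4 : J.card = 0 := by
        have : J.card < 1 := by exact_mod_cast h3
        omega
      have h5 : Q = 0 := by rw [hQdef, h4]; simp
      rw [h5]
      norm_num
  have hgap : ‖f (q + ρ • v) - g (q + ρ • v)‖ = L * ρ := by
    refine norm_bumpField_sub_self hv hρ.le ?_
    rw [show q + ρ • v - (q - ρ • v) = (2 * ρ) • v by module, norm_smul, hv, mul_one,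
      Real.norm_of_nonneg (by positivity)]
    linarith
  refine le_minimaxPointwiseRisk hf hg hμ (hEnv _) (hEnv _) fun e he => ?_
  refine le_trans (le_of_eq ?_) (le_pointwiseRisk_add hT.le hσ hf hg
    Metric.isClosed_closedBall.measurableSet hQ hμB hnb hsum he (q + ρ • v))
  rw [← ofReal_norm, hgap, show (4 : ℝ≥0∞) = ENNReal.ofReal 4 by simp,
    ← ENNReal.ofReal_div_of_pos (by norm_num), show (2 : ℝ≥0∞) = ENNReal.ofReal 2 by simp,
    ← ENNReal.ofReal_mul (by norm_num)]
  congr 1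
  ring

/-! ### Choice of the scale. -/

theorem mul_rpow_one_div_pow {c x : ℝ} (hx : 0 ≤ x) {k : ℕ} (hk : k ≠ 0) :
    (c * x ^ (1 / (k : ℝ))) ^ k = c ^ k * x := by
  rw [mul_pow, one_div, Real.rpow_inv_natCast_pow hx hk]

theorem rpow_one_div_le {x y r : ℝ} (hr : 0 < r) (hx : 0 ≤ x) {k : ℕ} (hk : k ≠ 0)
    (hy : 1 / r ^ k ≤ y) (hxy : x ≤ 1 / y) : x ^ (1 / (k : ℝ)) ≤ r := by
  have hr' : 0 < r ^ k := by positivity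
  have : x ≤ r ^ k := hxy.trans (by
    rw [div_le_iff₀ hr', mul_comm] at hy
    rwa [div_le_iff₀ (by nlinarith)])
  rw [one_div]
  exact (Real.rpow_inv_le_iff_of_pos hx hr.le (by positivity)).2 (by rwa [Real.rpow_natCast])

theorem corollary2 (D d : ℕ) (hd : 1 ≤ d) (L : ℝ≥0) (hL : 0 < L) (M : ℝ) (hM : 0 < M)
    (τ : ℝ) (hτ : 0 < τ) (ε : ℝ) (hε : 0 < ε) (T : ℝ) (hT : 0 < T) (σ : ℝ) (hσ : 0 < σ)
    (hne : (ManifoldClass D d τ ε).Nonempty) :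
    ∃ K : ℝ, 0 < K ∧ ∃ N : ℕ, ∀ n m : ℕ, N ≤ n → N ≤ m →
      ENNReal.ofReal (K * max (max ((1 / ((n : ℝ) * (m : ℝ))) ^ (1 / (5 + (d : ℝ))))
          ((1 / (n : ℝ)) ^ (1 / (d : ℝ)))) (1 / (m : ℝ))) ≤
        minimaxPointwiseRisk D d L M τ ε T σ n m := by
  obtain ⟨C₁, C₂, C₃, ρ₀, hC₁, hC₂, hC₃, hρ₀, key⟩ :=
    exists_le_minimaxPointwiseRisk_of_scale D d hd L M hM τ ε hε T hT σ hσ hne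
  have hL' : (0 : ℝ) < L := hL
  -- As `c ≤ 1`, its powers `c ^ d` and `c ^ (5 + d)` are at most `c`, so one shrinking factor
  -- serves all three regimes.
  set c : ℝ := min (min 1 (1 / (2 * C₃))) (min (1 / (2 * (C₁ + 1))) (1 / (2 * (C₁ * C₂ + 1))))
    with hc
  have hc0 : 0 < c := by positivity
  have hc1 : c ≤ 1 := (min_le_left _ _).trans (min_le_left _ _)
  have hcC₃ : C₃ * c ≤ 1 / 2 := by
    have : c ≤ 1 / (2 * C₃) := (min_le_left _ _).trans (min_le_right _ _)
    rw [le_div_iff₀ (by positivity)] at this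
    linarith
  have hcC₁ : C₁ * c ≤ 1 / 2 := by
    have : c ≤ 1 / (2 * (C₁ + 1)) := (min_le_right _ _).trans (min_le_left _ _)
    rw [le_div_iff₀ (by positivity)] at this
    linarith
  have hcC₂ : C₁ * C₂ * c ≤ 1 / 2 := by
    have : c ≤ 1 / (2 * (C₁ * C₂ + 1)) := (min_le_right _ _).trans (min_le_right _ _)
    rw [le_div_iff₀ (by positivity)] at this
    linarith
  -- These thresholds keep each candidate scale below `ρ₀`. Since `m ≥ 1`, `1 / (n * m) ≤ 1 / n`, so
  -- a condition on `n` alone controls the first one.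
  refine ⟨L * c / 8, by positivity,
    ⌈max 1 (max (1 / ρ₀) (max (1 / ρ₀ ^ d) (1 / ρ₀ ^ (5 + d))))⌉₊, fun n m hn hm => ?_⟩
  rw [Nat.ceil_le] at hn hm
  simp only [max_le_iff] at hn hm
  obtain ⟨hn1, -, hnd, hnd'⟩ := hn
  obtain ⟨hm1, hmρ, -, -⟩ := hm
  have hn0 : (0 : ℝ) < n := by linarith
  have hm0 : (0 : ℝ) < m := by linarith
  suffices h : ∀ x : ℝ, 0 < x → x ≤ ρ₀ →
      (n * (C₁ * (c * x) ^ d) ≤ 1 / 2 ∨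
        n * (C₁ * (c * x) ^ d) * (C₂ * (m * (c * x) ^ 5)) ≤ 1 / 2 ∨ C₃ * (c * x) * m < 1) →
      ENNReal.ofReal (L * c / 8 * x) ≤ minimaxPointwiseRisk D d L M τ ε T σ n m by
    rcases max_choice (max ((1 / ((n : ℝ) * (m : ℝ))) ^ (1 / (5 + (d : ℝ))))
      ((1 / (n : ℝ)) ^ (1 / (d : ℝ)))) (1 / (m : ℝ)) with h1 | h1
    · rw [h1]
      rcases max_choice ((1 / ((n : ℝ) * (m : ℝ))) ^ (1 / (5 + (d : ℝ))))
        ((1 / (n : ℝ)) ^ (1 / (d : ℝ))) with h2 | h2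
      · rw [h2, show (5 : ℝ) + d = ((5 + d : ℕ) : ℝ) by push_cast; ring]
        refine h _ (by positivity) (rpow_one_div_le hρ₀ (by positivity) (by omega) hnd' ?_)
          (Or.inr (Or.inl ?_))
        · gcongr
          nlinarith
        · set x := (1 / ((n : ℝ) * (m : ℝ))) ^ (1 / ((5 + d : ℕ) : ℝ)) with hx
          have e : (c * x) ^ (5 + d) = c ^ (5 + d) * (1 / ((n : ℝ) * m)) :=
            mul_rpow_one_div_pow (by positivity) (by omega)
          calc n * (C₁ * (c * x) ^ d) * (C₂ * (m * (c * x) ^ 5))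
              = C₁ * C₂ * (n * m) * (c * x) ^ (5 + d) := by ring
            _ = C₁ * C₂ * c ^ (5 + d) := by rw [e]; field_simp
            _ ≤ C₁ * C₂ * c := by
                gcongr
                exact pow_le_of_le_one hc0.le hc1 (by omega)
            _ ≤ 1 / 2 := hcC₂
      · rw [h2]
        refine h _ (by positivity) (rpow_one_div_le hρ₀ (by positivity) (by omega) hnd le_rfl)
          (Or.inl ?_)
        rw [mul_rpow_one_div_pow (by positivity) (by omega)]
        calc n * (C₁ * (c ^ d * (1 / (n : ℝ)))) = C₁ * c ^ d := by field_simp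
          _ ≤ C₁ * c := by
              gcongr
              exact pow_le_of_le_one hc0.le hc1 (by omega)
          _ ≤ 1 / 2 := hcC₁
    · rw [h1]
      refine h _ (by positivity) ?_ (Or.inr (Or.inr ?_))
      · rw [div_le_iff₀ hρ₀] at hmρ
        rw [div_le_iff₀ hm0]
        linarith
      · calc C₃ * (c * (1 / (m : ℝ))) * m = C₃ * c := by field_simp
          _ < 1 := by linarith
  intro x hx hxρ hx'
  have := key (c * x) (by positivity) ((mul_le_of_le_one_left hx.le hc1).trans hxρ) n m hx'
  rwa [show (L : ℝ) * (c * x) / 8 = L * c / 8 * x by ring] at this
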